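/- A weighted graph $\Gamma=(V\Gamma,E\Gamma,m)$ is a simplicial graph $(V\Gamma,E\Gamma)$ (undirected, without loops or multiple edges) together with a function $m\colon V\Gamma\times V\Gamma\to\{1,2,\dots\}\cup\{+\infty\}$ such that, for all $x,y\in V\Gamma$: $m(x,y)=m(y,x)$; $m(x,y)=1$ if and only if $x=y$; and, for $x\neq y$, $m(x,y)=+\infty$ if and only if $\{x,y\}\notin E\Gamma$. Its Coxeter group is $$W_\Gamma=\langle V\Gamma\mid (xy)^{m(x,y)}=e\ \text{ for all } x,y\in V\Gamma \text{ with } m(x,y)<+\infty\rangle .$$ Let $\mathrm{Aut}(\Gamma)$ be the group of bijections $\sigma$ of $V\Gamma$ with $m(\sigma(x),\sigma(y))=m(x,y)$ for all $x,y\in V\Gamma$, and for $x\in V\Gamma$ let $\mathrm{star}(x)=\{x\}\cup\{y\in V\Gamma\mid \{x,y\}\in E\Gamma\}$. Let $\mathcal C_\Gamma$ be the Cayley graph of $W_\Gamma$ with respect to $V\Gamma$, viewed as an unlabelled simplicial graph with vertex set $W_\Gamma$ in which $u$ and $v$ are adjacent if and only if $v=ux$ for some $x\in V\Gamma$, and let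 $\mathcal A_\Gamma$ be the group of all graph automorphisms of $\mathcal C_\Gamma$ (not necessarily preserving the labelling of the edges by generators). **Theorem A.** Let $\Gamma$ be a weighted graph with countable (finite or countably infinite) vertex set, and let $v$ be any vertex of $\mathcal C_\Gamma$. The stabiliser of $v$ in $\mathcal A_\Gamma$ is uncountable if and only if $\mathrm{Aut}(\Gamma)$ is uncountable, or there exist $x\in V\Gamma$ and a non-trivial $\alpha\in\mathrm{Aut}(\Gamma)$ such that $\alpha(y)=y$ for all $y\in\mathrm{star}(x)$. -/

import Mathlib

/-- A weighted graph on the vertex set `V`: a simplicial graph together with a symmetric weight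
function with values in `{1, 2, …} ∪ {∞}`, equal to `1` exactly on the diagonal, and finite on a
pair of distinct vertices exactly when they are joined by an edge. -/
structure WeightedGraph (V : Type*) where
  /-- The underlying simplicial graph. -/
  graph : SimpleGraph V
  /-- The weight function. -/
  weight : V → V → ℕ∞
  one_le_weight : ∀ x y, 1 ≤ weight x y
  weight_symm : ∀ x y, weight x y = weight y x
  weight_eq_one_iff : ∀ x y, weight x y = 1 ↔ x = y
  weight_eq_top_iff : ∀ x y, x ≠ y → (weight x y = ⊤ ↔ ¬ graph.Adj x y)

namespace WeightedGraph

/-- The star of `x`: the vertex `x` together with all vertices adjacent to it. -/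
def star {V : Type*} (Γ : WeightedGraph V) (x : V) : Set V :=
  {y | y = x ∨ Γ.graph.Adj x y}

/-- The group `Aut(Γ)` of weight-preserving bijections of the vertex set. -/
def aut {V : Type*} (Γ : WeightedGraph V) : Subgroup (Equiv.Perm V) where
  carrier := {σ | ∀ x y, Γ.weight x y = Γ.weight (σ x) (σ y)}
  one_mem' := fun _ _ => rfl
  mul_mem' := by
    intro σ τ hσ hτ x y
    exact (hτ x y).trans (hσ (τ x) (τ y))
  inv_mem' := by
    intro σ hσ x y
    have h := hσ (σ⁻¹ x) (σ⁻¹ y)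
    simpa using h.symm

/-- The Coxeter matrix of a weighted graph; in a `CoxeterMatrix` the entry `0` encodes the weight
`∞`, that is, the absence of a relation. -/
def coxeterMatrix {V : Type*} (Γ : WeightedGraph V) : CoxeterMatrix V where
  M := Matrix.of fun x y => (Γ.weight x y).toNat
  isSymm := by
    ext x y
    simp [Γ.weight_symm x y]
  diagonal := by
    intro x
    simp [(Γ.weight_eq_one_iff x x).2 rfl]
  off_diagonal := by
    intro x y hxy h
    apply hxy
    apply (Γ.weight_eq_one_iff x y).1
    have h' : (Γ.weight x y).toNat = 1 := h
    simpa using (ENat.toNat_eq_iff one_ne_zero).1 h'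

/-- The Coxeter group `W_Γ = ⟨V | (x y) ^ m(x, y) = 1⟩`. -/
abbrev coxeterGroup {V : Type*} (Γ : WeightedGraph V) : Type _ := Γ.coxeterMatrix.Group

/-- The Cayley graph of the Coxeter group `W_Γ` with respect to its standard generators, as an
unlabelled simplicial graph: `u` and `v` are joined by an edge when `v = u * x` for a standard
generator `x`. -/
def cayleyGraph {V : Type*} (Γ : WeightedGraph V) : SimpleGraph Γ.coxeterGroup :=
  SimpleGraph.mulCayley (Set.range Γ.coxeterMatrix.simple)

/-- The automorphism group `𝒜_Γ` of the Cayley graph (automorphisms need not preserve labels). -/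
abbrev cayleyAut {V : Type*} (Γ : WeightedGraph V) : Type _ := Γ.cayleyGraph ≃g Γ.cayleyGraph

/-- The stabiliser in `𝒜_Γ` of a vertex `v` of the Cayley graph. -/
abbrev vertexStabilizer {V : Type*} (Γ : WeightedGraph V) (v : Γ.coxeterGroup) :
    Subgroup Γ.cayleyAut :=
  MulAction.stabilizer Γ.cayleyAut v

end WeightedGraph

/-!
# Uncountable vertex stabilisers of automorphism groups of Cayley graphs of Coxeter groups

An automorphism `φ` of the Cayley graph permutes the labels of the edges at each vertex `w`; this is
its local action at `w`. Together with the image of one vertex, the local actions determine `φ`.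
They are described as follows.

* Every local action is an automorphism of `Γ` (`localPerm_mem_aut`), and the local actions at `w`
  and `w x` agree on the star of `x` (`localPerm_mul_simple_apply`). Indeed `φ` preserves the word
  metric. Let `x`, `y` have `m(x, y) < ∞`, and let `w₀` be the longest element of the dihedral group
  of `x` and `y`. Geodesics from `w` to `w w₀` start along either edge at `w`, so after applying `φ`
  there are two left descents `a`, `b`. An element with left descents `a`, `b` begins with the
  longest element of their dihedral group (`CoxeterSystem.exists_longest_altWord_prefix`), so
  `m(a, b) ≤ m(x, y)`, and equality holds by symmetry. Thus dihedral residues go to dihedral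
  residues.
* Conversely, every family of automorphisms of `Γ` with this compatibility along edges is the family
  of local actions of an automorphism fixing a given vertex (`exists_localPerm_eq`): the recipe for
  following a word letter by letter respects the Coxeter relations.

If only the identity fixes a star pointwise, the local actions of `φ` are all equal, and the
stabiliser of a vertex embeds into `Aut(Γ)`. For the converse, constant families embed `Aut(Γ)` into
the stabiliser. If `α ≠ 1` fixes the star of `x`, then any function from the left cosets of
`⟨V ∖ {x}⟩` to `{1, α}` is a compatible family; there are infinitely many cosets because `α` moves
some `y`, for which `m(x, y) = ∞`, and hence uncountably many such functions.

The facts about Coxeter groups that are needed, namely the order of a product of two generators and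
the exchange condition, come from the geometric representation and from the action of the group on
signed reflections, respectively.
-/

/-! ### The geometric representation -/

namespace CoxeterMatrix

variable {B : Type*} (M : CoxeterMatrix B)

/-- The simple coroot `α_i^∨` of the geometric representation of a Coxeter group on `B →₀ ℝ`: the
linear form with `α_i^∨ (α_j) = -2 cos (π / m_ij)`, where `α_j` is the basis vector at `j`. For
`m_ij = ∞`, encoded as `0`, division by zero yields the intended value `-2 cos 0 = -2`. -/
noncomputable def simpleCoroot (i : B) : Module.Dual ℝ (B →₀ ℝ) :=
  Finsupp.linearCombination ℝ fun j => -2 * Real.cos (Real.pi / M i j)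

lemma simpleCoroot_single (i j : B) :
    M.simpleCoroot i (Finsupp.single j 1) = -2 * Real.cos (Real.pi / M i j) := by
  simp [simpleCoroot]

lemma simpleCoroot_single_self (i : B) : M.simpleCoroot i (Finsupp.single i 1) = 2 := by
  simp [simpleCoroot_single]

/-- The simple reflection of the geometric representation. -/
noncomputable def simpleReflection (i : B) : (B →₀ ℝ) ≃ₗ[ℝ] (B →₀ ℝ) :=
  Module.reflection (M.simpleCoroot_single_self i)

lemma simpleReflection_apply (i : B) (z : B →₀ ℝ) :
    M.simpleReflection i z = z - M.simpleCoroot i z • Finsupp.single i 1 :=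
  Module.reflection_apply _ _

end CoxeterMatrix

open Polynomial.Chebyshev in
/-- The two Chebyshev coefficients of `(r₁ r₂) ^ m` vanish when `r₁ r₂` is a rotation by
`2 π / m`. -/
lemma chebyshev_S_rotation_coeff_eq_zero {m : ℕ} (hm : 3 ≤ m) :
    (S ℝ (((m : ℤ) - 2) / 2)).eval (2 * Real.cos (2 * (Real.pi / m))) *
      ((S ℝ (((m : ℤ) - 1) / 2)).eval (2 * Real.cos (2 * (Real.pi / m))) +
        (S ℝ (((m : ℤ) - 3) / 2)).eval (2 * Real.cos (2 * (Real.pi / m)))) = 0 ∧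
    (S ℝ (((m : ℤ) - 1) / 2)).eval (2 * Real.cos (2 * (Real.pi / m))) *
      ((S ℝ ((m : ℤ) / 2)).eval (2 * Real.cos (2 * (Real.pi / m))) +
        (S ℝ (((m : ℤ) - 2) / 2)).eval (2 * Real.cos (2 * (Real.pi / m)))) = 0 := by
  set φ : ℝ := 2 * (Real.pi / m) with hφ
  have hm0 : (0 : ℝ) < m := by positivity
  have hm3 : (3 : ℝ) ≤ m := by exact_mod_cast hm
  have hmφ : m * φ = 2 * Real.pi := by rw [hφ]; field_simp
  have hφ0 : 0 < φ := by positivity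
  have hφπ : φ < Real.pi := by nlinarith [Real.pi_pos]
  have hsin : Real.sin φ ≠ 0 := (Real.sin_pos_of_pos_of_lt_pi hφ0 hφπ).ne'
  have key : ∀ n : ℤ, (S ℝ n).eval (2 * Real.cos φ) = Real.sin ((n + 1) * φ) / Real.sin φ :=
    fun n => by rw [eq_div_iff hsin, S_two_mul_real_cos]
  rcases Nat.even_or_odd' m with ⟨k, hk | hk⟩
  · have e1 : ((m : ℤ) - 2) / 2 = k - 1 := by lia
    have e2 : ((m : ℤ) - 1) / 2 = k - 1 := by lia
    have hkφ : (k : ℝ) * φ = Real.pi := by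
      have : (m : ℝ) = 2 * k := by exact_mod_cast hk
      rw [this] at hmφ; linarith
    have h0 : (S ℝ ((k : ℤ) - 1)).eval (2 * Real.cos φ) = 0 := by
      rw [key]; push_cast; rw [sub_add_cancel, hkφ, Real.sin_pi, zero_div]
    rw [e1, e2, h0]; simp
  · have e1 : ((m : ℤ) - 2) / 2 = k - 1 := by lia
    have e2 : ((m : ℤ) - 1) / 2 = k := by lia
    have e3 : ((m : ℤ) - 3) / 2 = k - 1 := by lia
    have e4 : (m : ℤ) / 2 = k := by lia
    have hkφ : ((k : ℝ) + 1) * φ = 2 * Real.pi - k * φ := by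
      have : (m : ℝ) = 2 * k + 1 := by exact_mod_cast hk
      rw [this] at hmφ; linarith
    have h0 : (S ℝ (k : ℤ)).eval (2 * Real.cos φ) + (S ℝ ((k : ℤ) - 1)).eval (2 * Real.cos φ)
        = 0 := by
      rw [key, key]; push_cast
      rw [sub_add_cancel, hkφ, Real.sin_two_pi_sub]; ring
    rw [e1, e2, e3, e4, h0]; simp

namespace CoxeterMatrix

variable {B : Type*} (M : CoxeterMatrix B)

lemma isLiftable_simpleReflection : M.IsLiftable M.simpleReflection := by
  intro i j
  by_cases hij : i = j
  · subst hij
    ext1 z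
    simpa [simpleReflection] using
      Module.involutive_reflection (M.simpleCoroot_single_self i) z
  have h1 := M.off_diagonal i j hij
  obtain h0 | h2 | h3 : M i j = 0 ∨ M i j = 2 ∨ 3 ≤ M i j := by lia
  · rw [h0, pow_zero]
  · ext1 z
    have hi : M.simpleCoroot i (Finsupp.single j 1) = 0 := by
      rw [simpleCoroot_single, h2]; simp
    have hj : M.simpleCoroot j (Finsupp.single i 1) = 0 := by
      rw [simpleCoroot_single, M.symmetric, h2]; simp
    simp only [h2, pow_two, LinearEquiv.mul_apply, simpleReflection_apply, map_sub, map_smul, hi,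
      hj, simpleCoroot_single_self, LinearEquiv.coe_one, id]
    module
  · ext1 z
    have ht : (2 * Real.cos (2 * (Real.pi / M i j)) : ℝ) =
        M.simpleCoroot i (Finsupp.single j 1) * M.simpleCoroot j (Finsupp.single i 1) - 2 := by
      rw [simpleCoroot_single, simpleCoroot_single, M.symmetric j i, Real.cos_two_mul]; ring
    obtain ⟨c1, c2⟩ := chebyshev_S_rotation_coeff_eq_zero h3
    rw [simpleReflection, simpleReflection,
      Module.reflection_mul_reflection_pow_apply _ _ _ _ _ ht, c1, c2]
    simp

end CoxeterMatrix

namespace CoxeterSystem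

variable {B W : Type*} [Group W] {M : CoxeterMatrix B} (cs : CoxeterSystem M W)

/-- The geometric representation of a Coxeter group. -/
noncomputable def geometricRep : W →* ((B →₀ ℝ) ≃ₗ[ℝ] (B →₀ ℝ)) :=
  cs.lift ⟨M.simpleReflection, M.isLiftable_simpleReflection⟩

lemma geometricRep_simple (i : B) : cs.geometricRep (cs.simple i) = M.simpleReflection i :=
  cs.lift_apply_simple _ i

lemma geometricRep_simple_apply_of_ne {i k : B} (h : k ≠ i) (z : B →₀ ℝ) :
    cs.geometricRep (cs.simple i) z k = z k := by
  simp [geometricRep_simple, CoxeterMatrix.simpleReflection_apply, h.symm]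

lemma simple_injective : Function.Injective cs.simple := by
  intro i j h
  by_contra hij
  have h1 := cs.geometricRep_simple_apply_of_ne hij (Finsupp.single i 1)
  rw [← h, geometricRep_simple, CoxeterMatrix.simpleReflection_apply,
    CoxeterMatrix.simpleCoroot_single_self] at h1
  norm_num at h1

/-- For `m_ij = ∞`, the rotation `s_i s_j` acts on the plane of `α_i` and `α_j` by a transvection.
-/
lemma geometricRep_mul_pow_single_of_eq_zero {i j : B} (h : M i j = 0) (k : ℕ) :
    cs.geometricRep ((cs.simple i * cs.simple j) ^ k) (Finsupp.single i 1) =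
      (2 * k + 1 : ℝ) • Finsupp.single i 1 + (2 * k : ℝ) • Finsupp.single j 1 := by
  have hi : M.simpleCoroot i (Finsupp.single j 1) = -2 := by
    rw [CoxeterMatrix.simpleCoroot_single, h]; simp
  have hj : M.simpleCoroot j (Finsupp.single i 1) = -2 := by
    rw [CoxeterMatrix.simpleCoroot_single, M.symmetric, h]; simp
  induction k with
  | zero => simp
  | succ k ih =>
    rw [pow_succ', map_mul, LinearEquiv.mul_apply, ih, map_mul, LinearEquiv.mul_apply]
    simp only [geometricRep_simple, CoxeterMatrix.simpleReflection_apply, map_sub, map_add,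
      map_smul, hi, hj, CoxeterMatrix.simpleCoroot_single_self]
    push_cast
    module

/-- For `m_ij = m < ∞`, the rotation `s_i s_j` acts on the plane of `α_i` and `α_j` with angle
`2 π / m`. -/
lemma sin_smul_geometricRep_mul_pow_single (i j : B) (k : ℕ) :
    Real.sin (Real.pi / M i j) •
        cs.geometricRep ((cs.simple i * cs.simple j) ^ k) (Finsupp.single i 1) =
      Real.sin ((2 * k + 1) * (Real.pi / M i j)) • Finsupp.single i 1 +
        Real.sin (2 * k * (Real.pi / M i j)) • Finsupp.single j 1 := by
  set θ := Real.pi / M i j with hθ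
  have hi : M.simpleCoroot i (Finsupp.single j 1) = -2 * Real.cos θ :=
    CoxeterMatrix.simpleCoroot_single ..
  have hj : M.simpleCoroot j (Finsupp.single i 1) = -2 * Real.cos θ := by
    rw [CoxeterMatrix.simpleCoroot_single, M.symmetric]
  induction k with
  | zero => simp
  | succ k ih =>
    rw [pow_succ', map_mul, LinearEquiv.mul_apply, ← map_smul, ih, map_mul, LinearEquiv.mul_apply]
    simp only [geometricRep_simple, CoxeterMatrix.simpleReflection_apply, map_sub, map_add,
      map_smul, hi, hj, CoxeterMatrix.simpleCoroot_single_self]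
    have step : ∀ x : ℝ, Real.sin (x + 2 * θ) = 2 * Real.cos θ * Real.sin (x + θ) - Real.sin x := by
      intro x
      have h1 := Real.sin_add (x + θ) θ
      have h2 := Real.sin_sub (x + θ) θ
      rw [add_sub_cancel_right] at h2
      rw [show x + 2 * θ = x + θ + θ by ring, h1, h2]; ring
    have e1 := step (2 * k * θ)
    have e2 := step ((2 * k + 1) * θ)
    rw [show 2 * (k : ℝ) * θ + 2 * θ = 2 * ((k + 1 : ℕ) : ℝ) * θ by push_cast; ring,
      show 2 * (k : ℝ) * θ + θ = (2 * k + 1) * θ by ring] at e1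
    rw [show (2 * (k : ℝ) + 1) * θ + 2 * θ = (2 * ((k + 1 : ℕ) : ℝ) + 1) * θ by push_cast; ring,
      show (2 * (k : ℝ) + 1) * θ + θ = 2 * ((k + 1 : ℕ) : ℝ) * θ by push_cast; ring] at e2
    rw [e2, e1]
    module

/-- The order of `s_i s_j` is exactly `m_ij`; order `0` encodes infinite order. -/
theorem orderOf_simple_mul_simple (i j : B) : orderOf (cs.simple i * cs.simple j) = M i j := by
  by_cases hij : i = j
  · subst hij; simp
  by_cases h0 : M i j = 0
  · rw [h0, orderOf_eq_zero_iff']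
    intro n hn h
    have h1 := congrArg (· j) (cs.geometricRep_mul_pow_single_of_eq_zero h0 n)
    simp [h, hij] at h1
    lia
  · rw [orderOf_eq_iff (Nat.pos_of_ne_zero h0)]
    refine ⟨cs.simple_mul_simple_pow i j, fun k hk hk0 h => ?_⟩
    have h1 := M.off_diagonal i j hij
    have hm : (2 : ℝ) ≤ M i j := by exact_mod_cast (by lia : 2 ≤ M i j)
    have hkm : (k : ℝ) < M i j := by exact_mod_cast hk
    have hk0' : (0 : ℝ) < k := by exact_mod_cast hk0
    have hrot := cs.sin_smul_geometricRep_mul_pow_single i j k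
    set θ := Real.pi / M i j with hθ
    have hmθ : M i j * θ = Real.pi := by rw [hθ]; field_simp
    have hθ0 : 0 < θ := by positivity
    have hsin : 0 < Real.sin θ :=
      Real.sin_pos_of_pos_of_lt_pi hθ0 (by nlinarith)
    rw [h] at hrot
    have hi := congrArg (· i) hrot
    have hj := congrArg (· j) hrot
    simp [hij, Ne.symm hij] at hi hj
    -- `2kθ` lies strictly between `0` and `2π`, so it is `π`, but then `(s_i s_j) ^ k` negates `α_i`.
    have hπ : 2 * k * θ = Real.pi := by
      have h2 : Real.sin (2 * k * θ - Real.pi) = 0 := by rw [Real.sin_sub_pi, ← hj, neg_zero]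
      rw [Real.sin_eq_zero_iff_of_lt_of_lt] at h2
      · linarith
      · have : 0 < k * θ := by positivity
        linarith
      · nlinarith
    rw [add_mul, one_mul, hπ, add_comm, Real.sin_add_pi] at hi
    linarith

end CoxeterSystem

/-! ### The exchange condition -/

namespace CoxeterSystem

variable {B W : Type*} [Group W] {M : CoxeterMatrix B} (cs : CoxeterSystem M W)

lemma simple_mul_zpow_mul_simple {i j : B} (n : ℤ) :
    cs.simple j * (cs.simple i * cs.simple j) ^ n * cs.simple j =
      (cs.simple i * cs.simple j) ^ (-n) := by
  have h : cs.simple j * (cs.simple i * cs.simple j) * (cs.simple j)⁻¹ =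
      (cs.simple i * cs.simple j)⁻¹ := by simp [mul_assoc]
  rw [zpow_neg, ← inv_zpow, ← h, conj_zpow, inv_simple]

open Classical in
/-- The action of the simple reflection `s_i` on `W × ℤ/2`: conjugation in the first coordinate,
and a change of sign exactly at `t = s_i`. -/
noncomputable def signAct (i : B) : Function.End (W × ZMod 2) := fun p =>
  (cs.simple i * p.1 * cs.simple i, p.2 + if p.1 = cs.simple i then 1 else 0)

open Classical in
/-- The sign of `t` changes under `(s_i s_j) ^ k` once for each occurrence of `t` among the first
`2 k` reflections `(s_i s_j) ^ (-l) s_j` of the dihedral group. -/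
lemma signAct_mul_pow (i j : B) (k : ℕ) (t : W) (ε : ZMod 2) :
    ((cs.signAct i * cs.signAct j) ^ k) (t, ε) =
      ((cs.simple i * cs.simple j) ^ (k : ℤ) * t * (cs.simple i * cs.simple j) ^ (-k : ℤ),
        ε + ∑ l ∈ Finset.range (2 * k),
          if t = (cs.simple i * cs.simple j) ^ (-l : ℤ) * cs.simple j then 1 else 0) := by
  set r := cs.simple i * cs.simple j with hr
  have hjr : ∀ n : ℤ, cs.simple j * r ^ n = r ^ (-n) * cs.simple j := fun n => by
    rw [← cs.simple_mul_zpow_mul_simple n]; simp [hr]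
  induction k with
  | zero => simp; rfl
  | succ k ih =>
    rw [pow_succ']
    change (cs.signAct i * cs.signAct j) (((cs.signAct i * cs.signAct j) ^ k) (t, ε)) = _
    rw [ih]
    change cs.signAct i (cs.signAct j _) = _
    simp only [signAct]
    have hconj : ∀ a u : W, a * t * a⁻¹ = u ↔ t = a⁻¹ * u * a := fun a u =>
      ⟨fun h => by rw [← h]; group, fun h => by rw [h]; group⟩
    have e1 : (r ^ (k : ℤ) * t * r ^ (-k : ℤ) = cs.simple j) ↔
        (t = r ^ (-(2 * k : ℕ) : ℤ) * cs.simple j) := by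
      rw [zpow_neg, hconj, mul_assoc, hjr, ← zpow_neg, ← mul_assoc, ← zpow_add]
      push_cast
      rw [show -(2 * k : ℤ) = -k + -k by ring]
    have e2 : (cs.simple j * (r ^ (k : ℤ) * t * r ^ (-k : ℤ)) * cs.simple j = cs.simple i) ↔
        (t = r ^ (-(2 * k + 1 : ℕ) : ℤ) * cs.simple j) := by
      have h1 : r ^ (-(2 * k + 1 : ℕ) : ℤ) * cs.simple j =
          r ^ (-k : ℤ) * cs.simple j * cs.simple i * (cs.simple j * r ^ (k : ℤ)) := by
        rw [show -((2 * k + 1 : ℕ) : ℤ) = -k + (-1 + -k) by push_cast; ring, zpow_add, zpow_add,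
          hjr, mul_assoc, mul_assoc]
        simp [hr, mul_assoc]
      have h2 := hconj (cs.simple j * r ^ (k : ℤ)) (cs.simple i)
      rw [mul_inv_rev, inv_simple, ← zpow_neg] at h2
      rw [h1]
      simpa only [mul_assoc] using h2
    ext
    · rw [show ((k + 1 : ℕ) : ℤ) = 1 + k by push_cast; ring, neg_add_rev, zpow_add, zpow_add,
        zpow_one, zpow_neg_one]
      simp [hr, mul_assoc]
    · simp only [e1, e2]
      rw [show 2 * (k + 1) = 2 * k + 1 + 1 by ring, Finset.sum_range_succ, Finset.sum_range_succ]
      ring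

open Classical in
/-- The Coxeter relations hold because the reflections `(s_i s_j) ^ (-l) s_j` are periodic in `l`
with period `m_ij`, so that over `2 m_ij` steps all signs cancel. -/
lemma isLiftable_signAct : M.IsLiftable cs.signAct := by
  intro i j
  funext ⟨t, ε⟩
  rw [signAct_mul_pow]
  have h : (cs.simple i * cs.simple j) ^ (M i j : ℤ) = 1 := by
    rw [zpow_natCast, simple_mul_simple_pow]
  have hsum : ∑ l ∈ Finset.range (2 * M i j),
      (if t = (cs.simple i * cs.simple j) ^ (-l : ℤ) * cs.simple j then (1 : ZMod 2) else 0)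
        = 0 := by
    rw [two_mul, Finset.sum_range_add]
    have : ∀ l : ℕ, (cs.simple i * cs.simple j) ^ (-(M i j + l : ℕ) : ℤ) =
        (cs.simple i * cs.simple j) ^ (-l : ℤ) := by
      intro l
      rw [Nat.cast_add, neg_add, zpow_add, zpow_neg _ (M i j : ℤ), h]; simp
    simp only [this]
    exact CharTwo.add_self_eq_zero _
  rw [hsum, zpow_neg, h]
  simp; rfl

open Classical in
lemma lift_signAct_wordProd (ω : List B) (t : W) (ε : ZMod 2) :
    cs.lift ⟨cs.signAct, cs.isLiftable_signAct⟩ (cs.wordProd ω) (t, ε) =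
      (cs.wordProd ω * t * (cs.wordProd ω)⁻¹, ε + ((cs.rightInvSeq ω).count t : ZMod 2)) := by
  induction ω with
  | nil => simp; rfl
  | cons i ω ih =>
    rw [wordProd_cons, map_mul, lift_apply_simple]
    change cs.signAct i (cs.lift ⟨cs.signAct, cs.isLiftable_signAct⟩ (cs.wordProd ω) (t, ε)) = _
    rw [ih]
    simp only [signAct, rightInvSeq, List.count_cons]
    ext
    · simp [mul_assoc]
    · have : (cs.wordProd ω * t * (cs.wordProd ω)⁻¹ = cs.simple i) ↔
          ((cs.wordProd ω)⁻¹ * cs.simple i * cs.wordProd ω = t) := by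
        constructor
        · rintro h; rw [← h]; group
        · rintro h; rw [← h]; group
      simp only [this, beq_iff_eq]
      push_cast
      ring

open Classical in
/-- The parity of the number of occurrences of `t` in the left inversion sequence of a word only
depends on the product of the word. -/
theorem count_leftInvSeq_eq {ω ω' : List B} (h : cs.wordProd ω = cs.wordProd ω') (t : W) :
    ((cs.leftInvSeq ω).count t : ZMod 2) = (cs.leftInvSeq ω').count t := by
  have key : ∀ ω : List B, ((cs.leftInvSeq ω).count t : ZMod 2) =
      (cs.lift ⟨cs.signAct, cs.isLiftable_signAct⟩ (cs.wordProd ω)⁻¹ (t, 0)).2 := by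
    intro ω
    rw [← wordProd_reverse, lift_signAct_wordProd, rightInvSeq_reverse]
    simp
  rw [key, key, h]

/-- The exchange condition: a left descent of `π ω` occurs in the left inversion sequence of `ω`. -/
theorem simple_mem_leftInvSeq_of_isLeftDescent {ω : List B} {i : B}
    (h : cs.IsLeftDescent (cs.wordProd ω) i) : cs.simple i ∈ cs.leftInvSeq ω := by
  classical
  rw [isLeftDescent_iff] at h
  obtain ⟨τ, hτ, hτ'⟩ := cs.exists_isReduced (cs.simple i * cs.wordProd ω)
  have hw : cs.wordProd (i :: τ) = cs.wordProd ω := by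
    rw [wordProd_cons, ← hτ', simple_mul_simple_cancel_left]
  have hred : cs.IsReduced (i :: τ) := by
    rw [IsReduced, hw, ← h, hτ', hτ.eq]; simp
  have h1 : (cs.leftInvSeq (i :: τ)).count (cs.simple i) = 1 :=
    List.count_eq_one_of_mem hred.nodup_leftInvSeq (by simp [leftInvSeq])
  have h2 := cs.count_leftInvSeq_eq hw (cs.simple i)
  rw [h1] at h2
  by_contra hmem
  rw [List.count_eq_zero_of_not_mem hmem] at h2
  simp at h2

/-- A word without repetition in its left inversion sequence is reduced: every reduced word for the
same element has to contain all these reflections in its own sequence. -/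
theorem isReduced_of_nodup_leftInvSeq {ω : List B} (h : (cs.leftInvSeq ω).Nodup) :
    cs.IsReduced ω := by
  classical
  obtain ⟨τ, hτ, hτ'⟩ := cs.exists_isReduced (cs.wordProd ω)
  have hsub : cs.leftInvSeq ω ⊆ cs.leftInvSeq τ := by
    intro t ht
    have h2 := cs.count_leftInvSeq_eq hτ' t
    rw [List.count_eq_one_of_mem h ht] at h2
    by_contra hmem
    rw [List.count_eq_zero_of_not_mem hmem] at h2
    simp at h2
  have := (h.subperm hsub).length_le
  simp only [length_leftInvSeq] at this
  refine le_antisymm (cs.length_wordProd_le ω) ?_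
  rw [hτ', hτ.eq]
  exact this

lemma leftInvSeq_append (ω ω' : List B) :
    cs.leftInvSeq (ω ++ ω') =
      cs.leftInvSeq ω ++ (cs.leftInvSeq ω').map (MulAut.conj (cs.wordProd ω)) := by
  induction ω with
  | nil => simp
  | cons i ω ih => simp [leftInvSeq, ih, wordProd_cons]

end CoxeterSystem

/-! ### Alternating words and dihedral prefixes -/

namespace CoxeterSystem

variable {B W : Type*} [Group W] {M : CoxeterMatrix B} (cs : CoxeterSystem M W)

/-- The word `a b a b …` of length `k`, alternating between `a` and `b` and starting with `a`.
(Mathlib's `CoxeterSystem.alternatingWord` prescribes the last letter instead.) -/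
def altWord (a b : B) : ℕ → List B
  | 0 => []
  | k + 1 => a :: altWord b a k

@[simp]
lemma length_altWord (a b : B) (k : ℕ) : (altWord a b k).length = k := by
  induction k generalizing a b with
  | zero => rfl
  | succ k ih => simp [altWord, ih]

lemma leftInvSeq_altWord (a b : B) (k : ℕ) :
    cs.leftInvSeq (altWord a b k) =
      (List.range k).map fun p => (cs.simple a * cs.simple b) ^ p * cs.simple a := by
  induction k generalizing a b with
  | zero => rfl
  | succ k ih =>
    rw [altWord, leftInvSeq, ih, List.range_succ_eq_map, List.map_cons, List.map_map, List.map_map]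
    congr 1
    · simp
    · refine List.map_congr_left fun p _ => ?_
      have h : cs.simple a * (cs.simple b * cs.simple a) ^ p * cs.simple a =
          (cs.simple a * cs.simple b) ^ p := by
        have h1 : cs.simple a * (cs.simple b * cs.simple a) * (cs.simple a)⁻¹ =
            cs.simple a * cs.simple b := by simp [mul_assoc]
        rw [← h1, conj_pow, inv_simple]
      simp only [Function.comp, MulAut.conj_apply, inv_simple, ← mul_assoc]
      rw [pow_succ, ← h]
      simp [mul_assoc]

lemma dvd_of_mul_pow_mul_eq {a b : B} {p : ℕ}
    (h : (cs.simple a * cs.simple b) ^ p * cs.simple a = cs.simple b) : M a b ∣ p + 1 := by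
  rw [← cs.orderOf_simple_mul_simple]
  refine orderOf_dvd_of_pow_eq_one ?_
  rw [pow_succ, ← mul_assoc, h, simple_mul_simple_self]

lemma isReduced_altWord {a b : B} {k : ℕ} (hk : M a b ≠ 0 → k ≤ M a b) :
    cs.IsReduced (altWord a b k) := by
  apply cs.isReduced_of_nodup_leftInvSeq
  rw [leftInvSeq_altWord]
  refine List.Nodup.map_on ?_ List.nodup_range
  intro p hp q hq h
  rw [List.mem_range] at hp hq
  have h := mul_right_cancel h
  by_cases h0 : M a b = 0
  · rw [← cs.orderOf_simple_mul_simple] at h0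
    exact (pow_inj_iff_of_orderOf_eq_zero h0).1 h
  · refine pow_injOn_Iio_orderOf ?_ ?_ h <;>
    · rw [Set.mem_Iio, cs.orderOf_simple_mul_simple]
      have := hk h0
      lia

lemma isLeftDescent_of_mem_leftInvSeq {ω : List B} (hω : cs.IsReduced ω) {i : B}
    (h : cs.simple i ∈ cs.leftInvSeq ω) : cs.IsLeftDescent (cs.wordProd ω) i :=
  (cs.isLeftInversion_simple_iff_isLeftDescent _ _).1
    (cs.isLeftInversion_of_mem_leftInvSeq hω h)

/-- Both letters are left descents of the longest element of a finite dihedral subgroup. -/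
lemma isLeftDescent_longest_altWord {a b : B} (h0 : M a b ≠ 0) :
    cs.IsLeftDescent (cs.wordProd (altWord a b (M a b))) a ∧
      cs.IsLeftDescent (cs.wordProd (altWord a b (M a b))) b := by
  have hred : cs.IsReduced (altWord a b (M a b)) := cs.isReduced_altWord fun _ => le_rfl
  constructor <;> refine cs.isLeftDescent_of_mem_leftInvSeq hred ?_ <;>
    rw [leftInvSeq_altWord, List.mem_map]
  · exact ⟨0, List.mem_range.2 (Nat.pos_of_ne_zero h0), by simp⟩
  · refine ⟨M a b - 1, List.mem_range.2 (by lia), ?_⟩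
    have h := cs.simple_mul_simple_pow a b
    rw [← Nat.sub_one_add_one h0, pow_succ, ← mul_assoc] at h
    rw [eq_inv_of_mul_eq_one_left h, inv_simple]

/-- An element with left descents `a ≠ b` begins with every alternating word in `a` and `b` of
length at most `m_ab`, since the exchange condition extends shorter alternating prefixes. -/
lemma exists_altWord_prefix {w : W} (k : ℕ) {a b : B}
    (ha : cs.IsLeftDescent w a) (hb : cs.IsLeftDescent w b) (hk : M a b ≠ 0 → k ≤ M a b) :
    ∃ u, w = cs.wordProd (altWord a b k) * u ∧ cs.length w = k + cs.length u := by
  induction k generalizing a b with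
  | zero => exact ⟨w, by simp [altWord]⟩
  | succ k ih =>
    obtain ⟨u, hu, hl⟩ := ih hb ha (by rw [M.symmetric]; intro h; have := hk h; lia)
    obtain ⟨τ, hτ, rfl⟩ := cs.exists_isReduced u
    have hd := ha
    rw [hu, ← wordProd_append] at hd
    have hmem := cs.simple_mem_leftInvSeq_of_isLeftDescent hd
    rw [leftInvSeq_append, List.mem_append] at hmem
    rcases hmem with hmem | hmem
    -- A reflection in the alternating prefix can equal `s_a` only if that prefix has full length.
    · rw [leftInvSeq_altWord, List.mem_map] at hmem
      obtain ⟨p, hp, hpa⟩ := hmem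
      rw [List.mem_range] at hp
      have hdvd := cs.dvd_of_mul_pow_mul_eq hpa
      rw [M.symmetric] at hdvd
      have h0 : M a b ≠ 0 := by
        intro h0
        simp [h0] at hdvd
      have := hk h0
      have := Nat.le_of_dvd p.succ_pos hdvd
      lia
    -- Otherwise `s_a w` arises by deleting a letter after the prefix, and `a` can be prepended.
    · rw [List.mem_map] at hmem
      obtain ⟨t, ht, hta⟩ := hmem
      obtain ⟨j, hj, rfl⟩ := List.getElem_of_mem ht
      have hw : w = cs.wordProd (altWord a b (k + 1)) * cs.wordProd (τ.eraseIdx j) := by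
        rw [← getD_leftInvSeq_mul_wordProd, List.getD_eq_getElem _ _ hj]
        have h1 : cs.simple a * w =
            cs.wordProd (altWord b a k) * ((cs.leftInvSeq τ)[j] * cs.wordProd τ) := by
          rw [← hta, MulAut.conj_apply]
          rw [hu]
          group
        rw [altWord, wordProd_cons, mul_assoc, ← h1, simple_mul_simple_cancel_left]
      refine ⟨_, hw, ?_⟩
      rw [length_leftInvSeq] at hj
      have h1 := cs.length_wordProd_le (τ.eraseIdx j)
      rw [List.length_eraseIdx_of_lt hj] at h1
      have h2 := cs.length_mul_le (cs.wordProd (altWord a b (k + 1))) (cs.wordProd (τ.eraseIdx j))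
      rw [← hw] at h2
      have h3 := cs.length_wordProd_le (altWord a b (k + 1))
      rw [length_altWord] at h3
      rw [hτ.eq] at hl
      lia

/-- If `a` and `b` are distinct left descents of `w`, then `m_ab` is finite and `w` begins with the
longest element of the dihedral group of `a` and `b`. -/
theorem exists_longest_altWord_prefix {w : W} {a b : B}
    (ha : cs.IsLeftDescent w a) (hb : cs.IsLeftDescent w b) :
    M a b ≠ 0 ∧ ∃ u, w = cs.wordProd (altWord a b (M a b)) * u ∧
      cs.length w = M a b + cs.length u := by
  refine ⟨fun h0 => ?_, cs.exists_altWord_prefix _ ha hb fun _ => le_rfl⟩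
  obtain ⟨u, -, hu⟩ := cs.exists_altWord_prefix (cs.length w + 1) ha hb (absurd h0)
  lia

lemma geometricRep_mul_pow_apply_of_ne {a b c : B} (ha : c ≠ a) (hb : c ≠ b) (p : ℕ)
    (z : B →₀ ℝ) : cs.geometricRep ((cs.simple a * cs.simple b) ^ p) z c = z c := by
  induction p with
  | zero => simp
  | succ p ih =>
    rw [pow_succ', map_mul, map_mul, LinearEquiv.mul_apply, LinearEquiv.mul_apply,
      geometricRep_simple_apply_of_ne _ ha, geometricRep_simple_apply_of_ne _ hb, ih]

/-- An alternating word shorter than the longest one has only its first letter as a left descent. -/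
lemma eq_of_isLeftDescent_altWord {a b c : B} {k : ℕ} (hk : k < M a b)
    (hc : cs.IsLeftDescent (cs.wordProd (altWord a b k)) c) : c = a := by
  have hmem := cs.simple_mem_leftInvSeq_of_isLeftDescent hc
  rw [leftInvSeq_altWord, List.mem_map] at hmem
  obtain ⟨p, hp, h⟩ := hmem
  rw [List.mem_range] at hp
  by_contra hca
  by_cases hcb : c = b
  · subst hcb
    have := Nat.le_of_dvd p.succ_pos (cs.dvd_of_mul_pow_mul_eq h)
    lia
  · -- The reflection `s_c` negates the `c`-coordinate of `α_c`, but `s_a` and `s_b` preserve it.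
    have h1 := congrArg (fun g => cs.geometricRep g (Finsupp.single c 1) c) h
    simp only [map_mul, LinearEquiv.mul_apply] at h1
    rw [geometricRep_mul_pow_apply_of_ne _ hca hcb, geometricRep_simple_apply_of_ne _ hca,
      geometricRep_simple, CoxeterMatrix.simpleReflection_apply,
      CoxeterMatrix.simpleCoroot_single_self] at h1
    norm_num at h1

end CoxeterSystem

namespace WeightedGraph

open CoxeterSystem

variable {V : Type*} (Γ : WeightedGraph V)

/-- The canonical Coxeter system on `W_Γ`. -/
noncomputable abbrev coxeterSystem : CoxeterSystem Γ.coxeterMatrix Γ.coxeterGroup :=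
  Γ.coxeterMatrix.toCoxeterSystem

local notation "s" => Γ.coxeterSystem.simple
local notation "ℓ" => Γ.coxeterSystem.length

/-! ### Weights, stars and edges -/

lemma coxeterMatrix_apply (x y : V) : Γ.coxeterMatrix x y = (Γ.weight x y).toNat := rfl

lemma weight_eq_weight_iff {x y a b : V} :
    Γ.weight x y = Γ.weight a b ↔ Γ.coxeterMatrix x y = Γ.coxeterMatrix a b := by
  have h1 := Γ.one_le_weight x y
  have h2 := Γ.one_le_weight a b
  rw [coxeterMatrix_apply, coxeterMatrix_apply]
  generalize Γ.weight x y = p at *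
  generalize Γ.weight a b = q at *
  cases p <;> cases q
  · simp
  · simp only [ENat.toNat_top, ENat.toNat_natCast, ENat.top_ne_natCast, false_iff]
    rintro rfl
    simp at h2
  · simp only [ENat.toNat_top, ENat.toNat_natCast, ENat.natCast_ne_top, false_iff]
    rintro rfl
    simp at h1
  · simp

lemma mem_aut_iff {σ : Equiv.Perm V} :
    σ ∈ Γ.aut ↔ ∀ x y, Γ.coxeterMatrix x y = Γ.coxeterMatrix (σ x) (σ y) :=
  forall₂_congr fun _ _ => Γ.weight_eq_weight_iff

lemma mem_star_iff {x y : V} : y ∈ Γ.star x ↔ Γ.coxeterMatrix x y ≠ 0 := by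
  rw [coxeterMatrix_apply]
  by_cases h : x = y
  · subst h
    simp [star, (Γ.weight_eq_one_iff x x).2 rfl]
  · have h1 : Γ.weight x y ≠ 0 := (zero_lt_one.trans_le (Γ.one_le_weight x y)).ne'
    have h2 := Γ.weight_eq_top_iff x y h
    simp [star, Ne.symm h, ENat.toNat_eq_zero, h1, h2]

lemma mem_star_comm {x y : V} : y ∈ Γ.star x ↔ x ∈ Γ.star y := by
  rw [mem_star_iff, mem_star_iff, Γ.coxeterMatrix.symmetric]

lemma self_mem_star (x : V) : x ∈ Γ.star x := Or.inl rfl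

lemma cayleyGraph_adj {u v : Γ.coxeterGroup} : Γ.cayleyGraph.Adj u v ↔ ∃ x, v = u * s x := by
  rw [cayleyGraph, SimpleGraph.mulCayley_adj']
  constructor
  · rintro ⟨-, _, ⟨x, rfl⟩, h | h⟩
    · exact ⟨x, h.symm⟩
    · refine ⟨x, ?_⟩
      change u = v * s x at h
      rw [h, simple_mul_simple_cancel_right]
  · rintro ⟨x, rfl⟩
    refine ⟨fun h => ?_, _, ⟨x, rfl⟩, Or.inl rfl⟩
    have h1 := Γ.coxeterSystem.length_simple x
    rw [left_eq_mul.1 h, length_one] at h1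
    exact zero_ne_one h1

/-! ### Local actions of automorphisms of the Cayley graph -/

lemma exists_apply_mul_simple (φ : Γ.cayleyAut) (w : Γ.coxeterGroup) (x : V) :
    ∃ y, φ (w * s x) = φ w * s y :=
  Γ.cayleyGraph_adj.1 (φ.map_rel_iff.2 (Γ.cayleyGraph_adj.2 ⟨x, rfl⟩))

/-- The label of the image under `φ` of the edge at `w` labelled `x`. -/
noncomputable def localLabel (φ : Γ.cayleyAut) (w : Γ.coxeterGroup) (x : V) : V :=
  (Γ.exists_apply_mul_simple φ w x).choose

lemma apply_mul_simple_localLabel (φ : Γ.cayleyAut) (w : Γ.coxeterGroup) (x : V) :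
    φ (w * s x) = φ w * s (Γ.localLabel φ w x) :=
  (Γ.exists_apply_mul_simple φ w x).choose_spec

/-- The local action of an automorphism `φ` of the Cayley graph at a vertex `w`: the permutation of
the edge labels that `φ` induces from the edges at `w` to the edges at `φ w`. -/
noncomputable def localPerm (φ : Γ.cayleyAut) (w : Γ.coxeterGroup) : Equiv.Perm V where
  toFun := Γ.localLabel φ w
  invFun := Γ.localLabel φ.symm (φ w)
  left_inv x := by
    apply Γ.coxeterSystem.simple_injective
    refine mul_left_cancel (a := φ.symm (φ w)) ?_
    rw [← apply_mul_simple_localLabel, ← apply_mul_simple_localLabel]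
    simp
  right_inv y := by
    apply Γ.coxeterSystem.simple_injective
    refine mul_left_cancel (a := φ w) ?_
    rw [← apply_mul_simple_localLabel, eq_comm, ← φ.symm_apply_eq, apply_mul_simple_localLabel]
    simp

lemma apply_mul_simple (φ : Γ.cayleyAut) (w : Γ.coxeterGroup) (x : V) :
    φ (w * s x) = φ w * s (Γ.localPerm φ w x) :=
  Γ.apply_mul_simple_localLabel φ w x

lemma length_inv_mul_apply_le (φ : Γ.cayleyAut) (u v : Γ.coxeterGroup) :
    ℓ ((φ u)⁻¹ * φ v) ≤ ℓ (u⁻¹ * v) := by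
  obtain ⟨ω, hω, h⟩ := Γ.coxeterSystem.exists_isReduced (u⁻¹ * v)
  rw [h, hω.eq]
  obtain rfl : v = u * Γ.coxeterSystem.wordProd ω := by rw [← h]; group
  clear h hω
  induction ω generalizing u with
  | nil => simp
  | cons x ω ih =>
    rw [wordProd_cons, ← mul_assoc]
    have h := ih (u * s x)
    rw [apply_mul_simple] at h
    have h2 := Γ.coxeterSystem.length_mul_le (s (Γ.localPerm φ u x))
      ((φ u * s (Γ.localPerm φ u x))⁻¹ * φ (u * s x * Γ.coxeterSystem.wordProd ω))
    rw [mul_inv_rev, inv_simple, mul_assoc, simple_mul_simple_cancel_left, length_simple] at h2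
    rw [mul_inv_rev, inv_simple, mul_assoc] at h
    rw [List.length_cons]
    lia

/-- Automorphisms of the Cayley graph preserve the word metric. -/
lemma length_inv_mul_apply (φ : Γ.cayleyAut) (u v : Γ.coxeterGroup) :
    ℓ ((φ u)⁻¹ * φ v) = ℓ (u⁻¹ * v) := by
  refine le_antisymm (Γ.length_inv_mul_apply_le φ u v) ?_
  simpa using Γ.length_inv_mul_apply_le φ.symm (φ u) (φ v)

/-- An automorphism maps the vertex opposite to `w` in a dihedral residue to a vertex which can be
approached from `φ w` through either of the two image edges. -/
lemma isLeftDescent_apply_longest (φ : Γ.cayleyAut) (w : Γ.coxeterGroup) {x y a b : V}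
    (h0 : Γ.coxeterMatrix x y ≠ 0) (hx : φ (w * s x) = φ w * s a) (hy : φ (w * s y) = φ w * s b) :
    let w' := (φ w)⁻¹ * φ (w * Γ.coxeterSystem.wordProd (altWord x y (Γ.coxeterMatrix x y)))
    Γ.coxeterSystem.length w' = Γ.coxeterMatrix x y ∧
      Γ.coxeterSystem.IsLeftDescent w' a ∧ Γ.coxeterSystem.IsLeftDescent w' b := by
  intro w'
  have hl : ℓ w' = ℓ (Γ.coxeterSystem.wordProd (altWord x y (Γ.coxeterMatrix x y))) := by
    rw [length_inv_mul_apply, inv_mul_cancel_left]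
  have key : ∀ {z c : V}, φ (w * s z) = φ w * s c →
      Γ.coxeterSystem.IsLeftDescent
        (Γ.coxeterSystem.wordProd (altWord x y (Γ.coxeterMatrix x y))) z →
      Γ.coxeterSystem.IsLeftDescent w' c := by
    intro z c hz hd
    have h1 := Γ.length_inv_mul_apply φ (w * s z)
      (w * Γ.coxeterSystem.wordProd (altWord x y (Γ.coxeterMatrix x y)))
    rw [hz, mul_inv_rev, mul_inv_rev, inv_simple, inv_simple, mul_assoc, mul_assoc,
      inv_mul_cancel_left] at h1
    rw [IsLeftDescent] at hd ⊢
    rwa [h1, hl]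
  obtain ⟨hdx, hdy⟩ := Γ.coxeterSystem.isLeftDescent_longest_altWord h0
  refine ⟨?_, key hx hdx, key hy hdy⟩
  rw [hl, (Γ.coxeterSystem.isReduced_altWord fun _ => le_rfl).eq, length_altWord]

lemma coxeterMatrix_le_of_apply (φ : Γ.cayleyAut) (w : Γ.coxeterGroup) {x y a b : V}
    (h0 : Γ.coxeterMatrix x y ≠ 0) (hx : φ (w * s x) = φ w * s a) (hy : φ (w * s y) = φ w * s b) :
    Γ.coxeterMatrix a b ≠ 0 ∧ Γ.coxeterMatrix a b ≤ Γ.coxeterMatrix x y := by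
  obtain ⟨hl, ha, hb⟩ := Γ.isLeftDescent_apply_longest φ w h0 hx hy
  obtain ⟨h1, u, -, hu⟩ := Γ.coxeterSystem.exists_longest_altWord_prefix ha hb
  exact ⟨h1, by lia⟩

theorem localPerm_mem_aut (φ : Γ.cayleyAut) (w : Γ.coxeterGroup) : Γ.localPerm φ w ∈ Γ.aut := by
  rw [mem_aut_iff]
  intro x y
  have hx := Γ.apply_mul_simple φ w x
  have hy := Γ.apply_mul_simple φ w y
  have hsymm : ∀ {z c : V}, φ (w * s z) = φ w * s c →
      φ.symm (φ w * s c) = φ.symm (φ w) * s z := by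
    intro z c h
    rw [← h, φ.symm_apply_apply, φ.symm_apply_apply]
  have h1 := fun h => Γ.coxeterMatrix_le_of_apply φ w h hx hy
  have h2 := fun h => Γ.coxeterMatrix_le_of_apply φ.symm (φ w) h (hsymm hx) (hsymm hy)
  by_cases h : Γ.coxeterMatrix x y = 0
  · by_contra h'
    exact (h2 (fun h3 => h' (h.trans h3.symm))).1 h
  · exact le_antisymm (h2 (h1 h).1).2 (h1 h).2

/-- Adjacent vertices have local actions that agree on the star of the label of their edge: a
dihedral residue of finite type is mapped to another one, and its edges are labelled alternately. -/
theorem localPerm_mul_simple_apply (φ : Γ.cayleyAut) (w : Γ.coxeterGroup) {x y : V}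
    (h : y ∈ Γ.star x) : Γ.localPerm φ (w * s x) y = Γ.localPerm φ w y := by
  set a := Γ.localPerm φ w x with ha
  set b := Γ.localPerm φ w y with hb
  set c := Γ.localPerm φ (w * s x) y with hc
  have hφa : φ (w * s x) = φ w * s a := Γ.apply_mul_simple φ w x
  have hφb : φ (w * s y) = φ w * s b := Γ.apply_mul_simple φ w y
  have hφc : φ (w * s x * s y) = φ w * s a * s c := by rw [apply_mul_simple, hφa]
  by_cases hxy : x = y
  · subst hxy
    apply Γ.coxeterSystem.simple_injective
    rw [simple_mul_simple_cancel_right, eq_comm, mul_assoc, mul_eq_left] at hφc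
    rw [eq_inv_of_mul_eq_one_right hφc, inv_simple, hb]
  rw [mem_star_iff] at h
  obtain ⟨hl, hda, hdb⟩ := Γ.isLeftDescent_apply_longest φ w h hφa hφb
  have hm : Γ.coxeterMatrix x y = Γ.coxeterMatrix a b :=
    Γ.mem_aut_iff.1 (Γ.localPerm_mem_aut φ w) x y
  have h1 := Γ.coxeterMatrix.off_diagonal x y hxy
  -- The vertex opposite to `w` is mapped to the vertex opposite to `φ w` in the residue of `a`, `b`.
  obtain ⟨-, u, hu, hlu⟩ := Γ.coxeterSystem.exists_longest_altWord_prefix hda hdb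
  obtain rfl : u = 1 := by
    rw [← Γ.coxeterSystem.length_eq_zero_iff]; lia
  rw [mul_one, ← hm] at hu
  obtain ⟨m, hm2⟩ : ∃ m, Γ.coxeterMatrix x y = m + 2 := ⟨Γ.coxeterMatrix x y - 2, by lia⟩
  have hiso := Γ.length_inv_mul_apply φ (w * s x * s y)
    (w * Γ.coxeterSystem.wordProd (altWord x y (Γ.coxeterMatrix x y)))
  rw [hφc] at hiso
  simp only [mul_inv_rev, inv_simple, mul_assoc, inv_mul_cancel_left] at hiso
  rw [hu, hm2] at hiso
  simp only [altWord, wordProd_cons, simple_mul_simple_cancel_left] at hiso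
  -- The image of `w x y` lies on a geodesic to it, which has to continue with `b` after `a`.
  refine Γ.coxeterSystem.eq_of_isLeftDescent_altWord (a := b) (b := a) (k := m + 1) ?_ ?_
  · rw [Γ.coxeterMatrix.symmetric, ← hm]; lia
  · rw [IsLeftDescent, altWord, wordProd_cons, hiso, ← wordProd_cons]
    have h2 : Γ.coxeterSystem.IsReduced (altWord b a (m + 1)) :=
      Γ.coxeterSystem.isReduced_altWord fun _ => by
        rw [Γ.coxeterMatrix.symmetric, ← hm]; lia
    have h3 := Γ.coxeterSystem.length_wordProd_le (altWord x y m)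
    have h4 := h2.eq
    rw [altWord] at h4
    rw [h4]
    simp only [List.length_cons, length_altWord] at h3 ⊢
    lia

/-! ### Rigidity of the local action -/

lemma coxeterGroup_induction {v : Γ.coxeterGroup} {p : Γ.coxeterGroup → Prop} (hv : p v)
    (hs : ∀ w x, p w → p (w * s x)) (w : Γ.coxeterGroup) : p w := by
  have h : ∀ u, p (v * u) := fun u => by
    induction u using Γ.coxeterSystem.simple_induction_right with
    | one => rwa [mul_one]
    | mul_simple_right u x ih => rw [← mul_assoc]; exact hs _ _ ih
  simpa using h (v⁻¹ * w)

/-- Automorphisms with the same image of one vertex and the same local actions are equal. -/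
lemma eq_of_localPerm_eq {φ ψ : Γ.cayleyAut} {v : Γ.coxeterGroup} (hv : φ v = ψ v)
    (h : ∀ w, Γ.localPerm φ w = Γ.localPerm ψ w) : φ = ψ := by
  ext w
  induction w using Γ.coxeterGroup_induction (v := v) with
  | hv => exact hv
  | hs w x ih => rw [apply_mul_simple, apply_mul_simple, ih, h]

/-- If only the identity of `Γ` fixes a star pointwise, then every automorphism of the Cayley graph
has the same local action everywhere, so an automorphism fixing `v` is determined by its local
action at `v`. -/
theorem countable_vertexStabilizer (v : Γ.coxeterGroup) (hΓ : Countable Γ.aut)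
    (hrigid : ∀ x : V, ∀ α ∈ Γ.aut, (∀ y ∈ Γ.star x, α y = y) → α = 1) :
    Countable (Γ.vertexStabilizer v) := by
  have hconst : ∀ (φ : Γ.cayleyAut) w, Γ.localPerm φ w = Γ.localPerm φ v := by
    intro φ w
    induction w using Γ.coxeterGroup_induction (v := v) with
    | hv => rfl
    | hs w x ih =>
      rw [← ih, ← inv_mul_eq_one]
      refine hrigid x _ (mul_mem (inv_mem (Γ.localPerm_mem_aut φ _)) (Γ.localPerm_mem_aut φ _)) ?_
      intro y hy
      rw [Equiv.Perm.mul_apply, Equiv.Perm.inv_eq_iff_eq, Γ.localPerm_mul_simple_apply φ w hy]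
  let f : Γ.vertexStabilizer v → Γ.aut := fun φ => ⟨Γ.localPerm φ v, Γ.localPerm_mem_aut φ v⟩
  have hf : Function.Injective f := by
    rintro ⟨φ, hφ⟩ ⟨ψ, hψ⟩ h
    have h1 : Γ.localPerm φ v = Γ.localPerm ψ v := congrArg Subtype.val h
    rw [Subtype.mk.injEq]
    refine Γ.eq_of_localPerm_eq (v := v) (hφ.trans hψ.symm) fun w => ?_
    rw [hconst, h1, ← hconst ψ w]
  exact hf.countable

/-! ### Automorphisms with prescribed local actions -/

section Family

variable {Γ} {σ : Γ.coxeterGroup → Equiv.Perm V}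

lemma family_mul_pow_apply (hc : ∀ w x, ∀ y ∈ Γ.star x, σ (w * s x) y = σ w y)
    (w : Γ.coxeterGroup) {x y z : V} (hx : z ∈ Γ.star x) (hy : z ∈ Γ.star y) (k : ℕ) :
    σ (w * (s x * s y) ^ k) z = σ w z := by
  induction k with
  | zero => simp
  | succ k ih => rw [pow_succ, ← mul_assoc, ← mul_assoc, hc _ _ _ hy, hc _ _ _ hx, ih]

variable (σ) in
/-- The right action of generators on pairs `(w, g)` that follows the edge labelled `x` from `w` and
its prescribed image from `g`. -/
noncomputable def pairStep (x : V) : (Function.End (Γ.coxeterGroup × Γ.coxeterGroup))ᵐᵒᵖ :=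
  .op fun p => (p.1 * s x, p.2 * s (σ p.1 x))

variable (σ) in
/-- The right action of generators that lifts the edge labelled `a` at the image of `w` to the edge
at `w` which is to be mapped to it. -/
noncomputable def liftStep (a : V) : (Function.End Γ.coxeterGroup)ᵐᵒᵖ :=
  .op fun w => w * s ((σ w)⁻¹ a)

lemma isLiftable_pairStep (hσ : ∀ w, σ w ∈ Γ.aut)
    (hc : ∀ w x, ∀ y ∈ Γ.star x, σ (w * s x) y = σ w y) :
    Γ.coxeterMatrix.IsLiftable (pairStep σ) := by
  intro x y
  by_cases h0 : Γ.coxeterMatrix x y = 0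
  · rw [h0, pow_zero]
  have hxy : y ∈ Γ.star x := Γ.mem_star_iff.2 h0
  have key : ∀ k w g, ((pairStep σ x * pairStep σ y) ^ k).unop (w, g) =
      (w * (s x * s y) ^ k, g * (s (σ w x) * s (σ w y)) ^ k) := by
    intro k w g
    induction k with
    | zero => simp; rfl
    | succ k ih =>
      rw [pow_succ]
      change (pairStep σ x * pairStep σ y).unop
        (((pairStep σ x * pairStep σ y) ^ k).unop (w, g)) = _
      rw [ih]
      change (_ * s x * s y, _ * s (σ _ x) * s (σ (_ * s x) y)) = _
      rw [hc _ _ _ hxy, family_mul_pow_apply hc w (Γ.self_mem_star x) (Γ.mem_star_comm.1 hxy),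
        family_mul_pow_apply hc w hxy (Γ.self_mem_star y)]
      simp only [pow_succ, mul_assoc]
  apply MulOpposite.unop_injective
  funext ⟨w, g⟩
  rw [key, simple_mul_simple_pow, Γ.mem_aut_iff.1 (hσ w) x y, simple_mul_simple_pow]
  simp; rfl

lemma isLiftable_liftStep (hσ : ∀ w, σ w ∈ Γ.aut)
    (hc : ∀ w x, ∀ y ∈ Γ.star x, σ (w * s x) y = σ w y) :
    Γ.coxeterMatrix.IsLiftable (liftStep σ) := by
  intro a b
  by_cases h0 : Γ.coxeterMatrix a b = 0
  · rw [h0, pow_zero]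
  apply MulOpposite.unop_injective
  funext w
  obtain ⟨x, rfl⟩ := (σ w).surjective a
  obtain ⟨y, rfl⟩ := (σ w).surjective b
  rw [← Γ.mem_aut_iff.1 (hσ w) x y] at h0 ⊢
  have hxy : y ∈ Γ.star x := Γ.mem_star_iff.2 h0
  have key : ∀ k, ((liftStep σ (σ w x) * liftStep σ (σ w y)) ^ k).unop w =
      w * (s x * s y) ^ k := by
    intro k
    induction k with
    | zero => simp; rfl
    | succ k ih =>
      rw [pow_succ]
      change (liftStep σ (σ w x) * liftStep σ (σ w y)).unop
        (((liftStep σ (σ w x) * liftStep σ (σ w y)) ^ k).unop w) = _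
      rw [ih]
      have hx : (σ (w * (s x * s y) ^ k))⁻¹ (σ w x) = x := by
        rw [Equiv.Perm.inv_eq_iff_eq,
          family_mul_pow_apply hc w (Γ.self_mem_star x) (Γ.mem_star_comm.1 hxy)]
      have hy : (σ (w * (s x * s y) ^ k * s x))⁻¹ (σ w y) = y := by
        rw [Equiv.Perm.inv_eq_iff_eq, hc _ _ _ hxy,
          family_mul_pow_apply hc w hxy (Γ.self_mem_star y)]
      change _ * s ((σ _)⁻¹ (σ w x)) * s ((σ (_ * s ((σ _)⁻¹ (σ w x))))⁻¹ (σ w y)) = _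
      rw [hx, hy, pow_succ]
      simp only [mul_assoc]
  rw [key, simple_mul_simple_pow]
  simp; rfl

/-- A family of automorphisms of `Γ`, indexed by the vertices of the Cayley graph and compatible
along its edges, consists of the local actions of an automorphism fixing `v`. -/
theorem exists_localPerm_eq (v : Γ.coxeterGroup) (hσ : ∀ w, σ w ∈ Γ.aut)
    (hc : ∀ w x, ∀ y ∈ Γ.star x, σ (w * s x) y = σ w y) :
    ∃ φ : Γ.cayleyAut, φ v = v ∧ ∀ w, Γ.localPerm φ w = σ w := by
  let F := Γ.coxeterSystem.lift ⟨pairStep σ, isLiftable_pairStep hσ hc⟩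
  let G := Γ.coxeterSystem.lift ⟨liftStep σ, isLiftable_liftStep hσ hc⟩
  have hF : ∀ w x, (F (v⁻¹ * (w * s x))).unop (v, v) =
      (pairStep σ x).unop ((F (v⁻¹ * w)).unop (v, v)) := fun w x => by
    rw [← mul_assoc, map_mul]
    change (F (s x)).unop _ = _
    rw [show F (s x) = pairStep σ x from lift_apply_simple ..]
  have hG : ∀ g a, (G (v⁻¹ * (g * s a))).unop v =
      (liftStep σ a).unop ((G (v⁻¹ * g)).unop v) := fun g a => by
    rw [← mul_assoc, map_mul]
    change (G (s a)).unop _ = _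
    rw [show G (s a) = liftStep σ a from lift_apply_simple ..]
  let f : Γ.coxeterGroup → Γ.coxeterGroup := fun w => ((F (v⁻¹ * w)).unop (v, v)).2
  let g : Γ.coxeterGroup → Γ.coxeterGroup := fun w => (G (v⁻¹ * w)).unop v
  have hF1 : ∀ w, ((F (v⁻¹ * w)).unop (v, v)).1 = w := fun w => by
    induction w using Γ.coxeterGroup_induction (v := v) with
    | hv => rw [inv_mul_cancel, map_one]; rfl
    | hs w x ih =>
      rw [hF]
      exact congrArg (· * s x) ih
  have hfv : f v = v := by simp only [f]; rw [inv_mul_cancel, map_one]; rfl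
  have hgv : g v = v := by simp only [g]; rw [inv_mul_cancel, map_one]; rfl
  have hf : ∀ w x, f (w * s x) = f w * s (σ w x) := fun w x => by
    simp only [f]
    rw [hF]
    change _ * s (σ ((F (v⁻¹ * w)).unop (v, v)).1 x) = _
    rw [hF1]
  have hg : ∀ w a, g (w * s a) = g w * s ((σ (g w))⁻¹ a) := fun w a => hG w a
  have hgf : Function.LeftInverse g f := fun w => by
    induction w using Γ.coxeterGroup_induction (v := v) with
    | hv => rw [hfv, hgv]
    | hs w x ih => rw [hf, hg, ih]; simp
  have hfg : Function.RightInverse g f := fun w => by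
    induction w using Γ.coxeterGroup_induction (v := v) with
    | hv => rw [hgv, hfv]
    | hs w x ih => rw [hg, hf, ih]; simp
  let φ : Γ.cayleyAut :=
    { toFun := f
      invFun := g
      left_inv := hgf
      right_inv := hfg
      map_rel_iff' := by
        intro u w
        rw [cayleyGraph_adj, cayleyGraph_adj]
        constructor
        · rintro ⟨a, ha⟩
          change f w = f u * s a at ha
          refine ⟨(σ u)⁻¹ a, ?_⟩
          rw [← hgf w, ha, hg, hgf u]
        · rintro ⟨x, rfl⟩
          exact ⟨σ u x, hf u x⟩ }
  refine ⟨φ, hfv, fun w => Equiv.ext fun x => ?_⟩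
  apply Γ.coxeterSystem.simple_injective
  refine mul_left_cancel (a := φ w) ?_
  rw [← apply_mul_simple]
  exact hf w x

end Family

lemma uncountable_vertexStabilizer_of_injective (v : Γ.coxeterGroup) {ι : Type*} [Uncountable ι]
    {σ : ι → Γ.coxeterGroup → Equiv.Perm V} (hinj : Function.Injective σ)
    (hσ : ∀ i w, σ i w ∈ Γ.aut)
    (hc : ∀ i w x, ∀ y ∈ Γ.star x, σ i (w * s x) y = σ i w y) :
    Uncountable (Γ.vertexStabilizer v) := by
  choose φ hφv hφ using fun i => exists_localPerm_eq v (hσ i) (hc i)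
  let f : ι → Γ.vertexStabilizer v := fun i => ⟨φ i, hφv i⟩
  have hf : Function.Injective f := by
    intro i j h
    have h1 : φ i = φ j := congrArg Subtype.val h
    refine hinj (funext fun w => ?_)
    rw [← hφ, ← hφ, h1]
  exact hf.uncountable

lemma uncountable_vertexStabilizer_of_aut (v : Γ.coxeterGroup) [Uncountable Γ.aut] :
    Uncountable (Γ.vertexStabilizer v) := by
  refine Γ.uncountable_vertexStabilizer_of_injective v (σ := fun (α : Γ.aut) _ => α)
    (fun α β h => Subtype.ext (congrFun h 1)) (fun α _ => α.2) (fun _ _ _ _ _ => rfl)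

/-- Let `α ≠ 1` fix the star of `x` pointwise. A family with values in `{1, α}` is compatible as
soon as it is constant on the left cosets of the subgroup generated by the vertices other than `x`.
A vertex `y` moved by `α` has `m_xy = ∞`, which makes infinitely many such cosets; they are
distinguished by the `x`-coordinate of `w⁻¹ α_y` in the geometric representation. -/
lemma uncountable_vertexStabilizer_of_fix_star (v : Γ.coxeterGroup) {x : V} {α : Equiv.Perm V}
    (hα : α ∈ Γ.aut) (hα1 : α ≠ 1) (hfix : ∀ y ∈ Γ.star x, α y = y) :
    Uncountable (Γ.vertexStabilizer v) := by
  classical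
  have : Uncountable (Set ℕ) := by
    rw [← not_countable_iff]
    intro
    obtain ⟨f, hf⟩ := exists_surjective_nat (Set ℕ)
    exact Function.cantor_surjective f hf
  obtain ⟨y, hy⟩ : ∃ y, α y ≠ y := by
    by_contra! h
    exact hα1 (Equiv.ext h)
  have hyx : Γ.coxeterMatrix y x = 0 := by
    rw [Γ.coxeterMatrix.symmetric]
    by_contra h
    exact hy (hfix y (Γ.mem_star_iff.2 h))
  let coord : Γ.coxeterGroup → ℝ := fun w =>
    Γ.coxeterSystem.geometricRep w⁻¹ (Finsupp.single y 1) x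
  have hcoord : ∀ w z, z ≠ x → coord (w * s z) = coord w := by
    intro w z hz
    simp only [coord]
    rw [mul_inv_rev, inv_simple, map_mul, LinearEquiv.mul_apply,
      geometricRep_simple_apply_of_ne _ hz.symm]
  have hne : y ≠ x := fun h => hy (hfix y (h ▸ Γ.self_mem_star x))
  have hpow : ∀ k : ℕ, coord ((s y * s x) ^ k)⁻¹ = 2 * k := by
    intro k
    simp only [coord]
    rw [inv_inv, geometricRep_mul_pow_single_of_eq_zero _ hyx]
    simp [hne]
  let σ : Set ℕ → Γ.coxeterGroup → Equiv.Perm V := fun A w =>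
    if ∃ k ∈ A, coord w = 2 * k then α else 1
  have hσ : ∀ A w, σ A w = 1 ∨ σ A w = α := fun A w => by
    simp only [σ]; split_ifs <;> simp
  refine Γ.uncountable_vertexStabilizer_of_injective v (σ := σ) ?_ ?_ ?_
  · intro A A' h
    ext k
    have h1 := congrFun h ((s y * s x) ^ k)⁻¹
    simp only [σ, hpow] at h1
    have h2 : ∀ A : Set ℕ, (∃ l ∈ A, (2 * k : ℝ) = 2 * l) ↔ k ∈ A := by simp
    simp only [h2] at h1
    by_cases hA : k ∈ A <;> by_cases hA' : k ∈ A' <;> simp_all [eq_comm]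
  · intro A w
    rcases hσ A w with h | h <;> rw [h]
    · exact one_mem _
    · exact hα
  · intro A w z u hu
    by_cases hz : z = x
    · subst hz
      have h : ∀ w, σ A w u = u := fun w => by
        rcases hσ A w with h | h <;> rw [h]
        · rfl
        · exact hfix u hu
      rw [h, h]
    · simp only [σ, hcoord w z hz]

end WeightedGraph

theorem theoremA {V : Type*} [Countable V] (Γ : WeightedGraph V) (v : Γ.coxeterGroup) :
    Uncountable (Γ.vertexStabilizer v) ↔
      (Uncountable Γ.aut ∨
        ∃ x : V, ∃ α ∈ Γ.aut, α ≠ 1 ∧ ∀ y ∈ Γ.star x, α y = y) := by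
  constructor
  · contrapose!
    rintro ⟨haut, hrigid⟩
    refine Γ.countable_vertexStabilizer v haut fun x α hα hfix => ?_
    by_contra hα1
    obtain ⟨y, hy, hne⟩ := hrigid x α hα hα1
    exact hne (hfix y hy)
  · rintro (haut | ⟨x, α, hα, hα1, hfix⟩)
    · exact Γ.uncountable_vertexStabilizer_of_aut v
    · exact Γ.uncountable_vertexStabilizer_of_fix_star v hα hα1 hfix
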